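/- Let $\mathcal{H}$ be a finite-dimensional complex Hilbert space, let $\mathcal{H}_R \subseteq \mathcal{H}$ be a nonzero linear subspace of dimension $d_R$, and let $\Pi_R$ be the orthogonal projector onto $\mathcal{H}_R$. Let $B$ be an observable, i.e. a self-adjoint linear operator on $\mathcal{H}$, let $\|B\|_\infty$ be its operator norm, and set $\langle B\rangle_{\mathrm{mc}} := \mathrm{Tr}[B\,\Pi_R/d_R]$. Let $\psi$ be a random pure state of $\mathcal{H}_R$, i.e. a random rank-one orthogonal projector on $\mathcal{H}_R$ (regarded as an operator on $\mathcal{H}$ that vanishes on $\mathcal{H}_R^\perp$) distributed according to the Haar measure, the unique probability measure on the set of these projectors that is invariant under $\psi \mapsto U\psi U^\dagger$ for all unitaries $U$ of $\mathcal{H}_R$; equivalently, $\psi = |v\rangle\langle v|$ with $v$ uniformly distributed on the unit sphere of $\mathcal{H}_R$. Then for every $\varepsilon > 0$ $$\Pr\bigl\{\,|\mathrm{Tr}[B\psi] - \langle B\rangle_{\mathrm{mc}}| \ge \varepsilon\,\bigr\} \;\le\; 2\exp\!\left(-\frac{C\, d_R\, \varepsilon^2}{\|B\|_\infty^2}\right),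 \qquad C = \frac{1}{36\pi^3},$$ where for $B = 0$ the right-hand side is read as $0$. -/

import Mathlib

open MeasureTheory

noncomputable section

namespace QStat

section PureStates

variable (E : Type*) [NormedAddCommGroup E] [InnerProductSpace ℂ E]

/-- The pure states of a quantum system with Hilbert space `E`: the rank-one orthogonal
projectors on `E`. -/
def PureState : Type _ :=
  {P : E →L[ℂ] E // (P : E →ₗ[ℂ] E).IsSymmetricProjection ∧
    Module.finrank ℂ (LinearMap.range (P : E →ₗ[ℂ] E)) = 1}

/-- The Borel σ-algebra of the operator norm topology, restricted to the pure states. -/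
instance : MeasurableSpace (PureState E) :=
  inferInstanceAs (MeasurableSpace {P : E →L[ℂ] E // (P : E →ₗ[ℂ] E).IsSymmetricProjection ∧
    Module.finrank ℂ (LinearMap.range (P : E →ₗ[ℂ] E)) = 1})

variable {E}

/-- The pure density operator `|v⟩⟨v|` of a normalized state vector `v`. -/
def PureState.ofVector (v : Metric.sphere (0 : E) 1) : PureState E :=
  ⟨InnerProductSpace.rankOne ℂ (v : E) (v : E), by
    have hv : ‖(v : E)‖ = 1 := by simp
    refine ⟨InnerProductSpace.isSymmetricProjection_rankOne_self hv, ?_⟩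
    have h0 : (v : E) ≠ 0 := fun h => by simp [h] at hv
    have h1 : LinearMap.range
        ((InnerProductSpace.rankOne ℂ (v : E) (v : E) : E →L[ℂ] E) : E →ₗ[ℂ] E)
          = Submodule.span ℂ {(v : E)} := by
      ext x
      simp only [LinearMap.mem_range, Submodule.mem_span_singleton]
      constructor
      · rintro ⟨y, rfl⟩
        exact ⟨inner ℂ (v : E) y, rfl⟩
      · rintro ⟨a, rfl⟩
        refine ⟨a • (v : E), ?_⟩
        simp [inner_self_eq_norm_sq_to_K]
    rw [h1, finrank_span_singleton h0]⟩

lemma PureState.measurable_ofVector [MeasurableSpace E] [BorelSpace E] :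
    Measurable (PureState.ofVector : Metric.sphere (0 : E) 1 → PureState E) := by
  have hc : Continuous fun v : Metric.sphere (0 : E) 1 =>
      (InnerProductSpace.rankOne ℂ (v : E) (v : E) : E →L[ℂ] E) := by
    have h1 : Continuous fun v : Metric.sphere (0 : E) 1 => innerSL ℂ (v : E) :=
      (innerSL ℂ).continuous.comp continuous_subtype_val
    have h2 := h1.prodMk (continuous_subtype_val (p := fun v => v ∈ Metric.sphere (0 : E) 1))
    exact (ContinuousLinearMap.smulRightL ℂ E E).continuous₂.comp h2
  exact hc.measurable.subtype_mk

/-- The pure state `U ψ U†`, for a unitary `U`. -/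
def PureState.conj (U : E ≃ₗᵢ[ℂ] E) (ψ : PureState E) : PureState E :=
  ⟨(U : E →L[ℂ] E) ∘L ψ.1 ∘L (U.symm : E →L[ℂ] E), by
    obtain ⟨P, ⟨hid, hsym⟩, hrank⟩ := ψ
    refine ⟨⟨?_, ?_⟩, ?_⟩
    · have h : ∀ x, P (P x) = P x := fun x => LinearMap.congr_fun hid x
      ext x
      simp [h]
    · intro x y
      have h := hsym (U.symm x) (U.symm y)
      have e1 := U.inner_map_map (P (U.symm x)) (U.symm y)
      have e2 := U.inner_map_map (U.symm x) (P (U.symm y))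
      simp only [LinearIsometryEquiv.apply_symm_apply] at e1 e2
      exact e1.trans (h.trans e2.symm)
    · have h1 : LinearMap.range
          (((U : E →L[ℂ] E) ∘L P ∘L (U.symm : E →L[ℂ] E) : E →L[ℂ] E) : E →ₗ[ℂ] E)
            = (LinearMap.range (P : E →ₗ[ℂ] E)).map (U.toLinearEquiv : E →ₗ[ℂ] E) := by
        ext x
        simp only [LinearMap.mem_range, Submodule.mem_map]
        constructor
        · rintro ⟨y, rfl⟩
          exact ⟨P (U.symm y), ⟨U.symm y, rfl⟩, rfl⟩
        · rintro ⟨_, ⟨y, rfl⟩, rfl⟩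
          exact ⟨U y, by simp⟩
      rw [h1, LinearEquiv.finrank_map_eq, hrank]⟩

/-- The action of a unitary on unit vectors. -/
def sphereMap (U : E ≃ₗᵢ[ℂ] E) (v : Metric.sphere (0 : E) 1) : Metric.sphere (0 : E) 1 :=
  ⟨U v, by simp⟩

lemma measurable_sphereMap [MeasurableSpace E] [BorelSpace E] (U : E ≃ₗᵢ[ℂ] E) : Measurable (sphereMap U) :=
  (U.continuous.comp continuous_subtype_val).measurable.subtype_mk

lemma PureState.measurable_conj (U : E ≃ₗᵢ[ℂ] E) : Measurable (PureState.conj U) := by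
  have hc : Continuous fun P : E →L[ℂ] E => (U : E →L[ℂ] E) ∘L P ∘L (U.symm : E →L[ℂ] E) := by
    fun_prop
  exact (hc.measurable.comp measurable_subtype_coe).subtype_mk

variable (E) [FiniteDimensional ℂ E] [MeasurableSpace E] [BorelSpace E]

/-- Lebesgue measure on `E`, regarded as a real Euclidean space with the inner product
`Re ⟨x, y⟩`. -/
def lebesgue : Measure E :=
  letI : InnerProductSpace ℝ E := InnerProductSpace.complexToReal
  haveI : FiniteDimensional ℝ E := FiniteDimensional.complexToReal E
  volume

instance isAddHaarMeasure_lebesgue : (lebesgue E).IsAddHaarMeasure := by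
  let _ : InnerProductSpace ℝ E := InnerProductSpace.complexToReal
  have : FiniteDimensional ℝ E := FiniteDimensional.complexToReal E
  exact inferInstanceAs (volume : Measure E).IsAddHaarMeasure

/-- The uniform probability measure on the unit sphere of `E`: surface measure divided by its total
mass. -/
def uniformSphere : Measure (Metric.sphere (0 : E) 1) :=
  ((lebesgue E).toSphere Set.univ)⁻¹ • (lebesgue E).toSphere

/-- The Haar measure on the pure states of `E`, that is, the law of `|v⟩⟨v|` for a uniformly random
unit vector `v`. By `isProbabilityMeasure_haar` and `haar_map_conj` below it is a probability
measure (if `E ≠ 0`) and invariant under all unitaries of `E`. -/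
def PureState.haar : Measure (PureState E) :=
  (uniformSphere E).map PureState.ofVector

instance isProbabilityMeasure_uniformSphere [Nontrivial E] :
    IsProbabilityMeasure (uniformSphere E) := by
  have h0 : (lebesgue E).toSphere Set.univ ≠ 0 := by
    rw [Ne, Measure.measure_univ_eq_zero]
    exact Measure.toSphere_ne_zero _
  exact ⟨by
    rw [uniformSphere, Measure.smul_apply, smul_eq_mul]
    exact ENNReal.inv_mul_cancel h0 (measure_ne_top _ _)⟩

instance isProbabilityMeasure_haar [Nontrivial E] :
    IsProbabilityMeasure (PureState.haar E) :=
  Measure.isProbabilityMeasure_map PureState.measurable_ofVector.aemeasurable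

variable {E}

lemma uniformSphere_map (U : E ≃ₗᵢ[ℂ] E) :
    (uniformSphere E).map (sphereMap U) = uniformSphere E := by
  have hU : MeasurePreserving U (lebesgue E) (lebesgue E) := by
    let _ : InnerProductSpace ℝ E := InnerProductSpace.complexToReal
    have : FiniteDimensional ℝ E := FiniteDimensional.complexToReal E
    exact (LinearIsometryEquiv.mk (U.toLinearEquiv.restrictScalars ℝ) U.norm_map).measurePreserving
  have key : (lebesgue E).toSphere.map (sphereMap U) = (lebesgue E).toSphere := by
    ext s hs
    rw [Measure.map_apply (measurable_sphereMap U) hs, Measure.toSphere_apply' _ hs,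
      Measure.toSphere_apply' _ (measurable_sphereMap U hs)]
    congr 1
    refine Eq.trans ?_
      (MeasurePreserving.measure_preimage_equiv (f := U.toHomeomorph.toMeasurableEquiv) hU _)
    congr 1
    ext x
    simp only [Set.mem_smul, Set.mem_preimage, Set.mem_image]
    constructor
    · rintro ⟨r, hr, _, ⟨v, hv, rfl⟩, rfl⟩
      exact ⟨r, hr, U v, ⟨sphereMap U v, hv, rfl⟩, (U.map_smul_of_tower r (v : E)).symm⟩
    · rintro ⟨r, hr, _, ⟨v, hv, rfl⟩, hx⟩
      refine ⟨r, hr, U.symm v, ⟨sphereMap U.symm v, ?_, rfl⟩, ?_⟩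
      · have : sphereMap U (sphereMap U.symm v) = v := Subtype.ext (by simp [sphereMap])
        simpa [this] using hv
      · apply U.injective
        refine Eq.trans (U.map_smul_of_tower r (U.symm (v : E))) ?_
        exact (congrArg (fun y => r • y) (U.apply_symm_apply (v : E))).trans hx
  rw [uniformSphere, Measure.map_smul, key]

/-- Unitary invariance of the Haar measure on pure states. -/
theorem haar_map_conj (U : E ≃ₗᵢ[ℂ] E) :
    (PureState.haar E).map (PureState.conj U) = PureState.haar E := by
  have h : PureState.conj U ∘ PureState.ofVector = PureState.ofVector ∘ sphereMap U := by
    funext v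
    apply Subtype.ext
    ext x
    have : inner ℂ (v : E) (U.symm x) = inner ℂ (U v) x := by
      rw [← U.inner_map_map, U.apply_symm_apply]
    simp [PureState.conj, PureState.ofVector, sphereMap, this]
  rw [PureState.haar, Measure.map_map (PureState.measurable_conj U) PureState.measurable_ofVector,
    h, ← Measure.map_map PureState.measurable_ofVector (measurable_sphereMap U),
    uniformSphere_map]

end PureStates

section Expectation

variable {H : Type*} [NormedAddCommGroup H] [InnerProductSpace ℂ H] [FiniteDimensional ℂ H]

/-- A pure state of a subspace `K` regarded as an operator on the whole space: it acts as `ψ`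
on `K` and as `0` on the orthogonal complement of `K`. -/
def PureState.extend {K : Submodule ℂ H} (ψ : PureState K) : H →L[ℂ] H :=
  K.subtypeL ∘L ψ.1 ∘L K.orthogonalProjectionOnto

/-- `Tr[B ψ]`, the expectation value of `B` in the pure state `ψ` of the subspace `K`. -/
def expectation {K : Submodule ℂ H} (B : H →L[ℂ] H) (ψ : PureState K) : ℂ :=
  LinearMap.trace ℂ H (B ∘L ψ.extend : H →L[ℂ] H)

/-- The microcanonical state `Π_K / d_K` of the subspace `K`. -/
def microcanonicalState (K : Submodule ℂ H) : H →L[ℂ] H :=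
  (Module.finrank ℂ K : ℂ)⁻¹ • K.starProjection

/-- `⟨B⟩_mc = Tr[B Π_K / d_K]`, the microcanonical expectation value of `B` with respect to `K`. -/
def microcanonicalExpectation (K : Submodule ℂ H) (B : H →L[ℂ] H) : ℂ :=
  LinearMap.trace ℂ H (B ∘L microcanonicalState K : H →L[ℂ] H)

end Expectation

end QStat

end

/-! On unit vectors `v` of `K`, `Tr[Bψ]` is the quadratic form of the compression of `B` to `K`. In
an orthonormal eigenbasis with eigenvalues `l i` of mean `m`, its deviation from the microcanonical
value is `∑ (l i - m) |v i|²`. No Lipschitz or isoperimetric estimate is needed, because such a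
diagonal form has an explicit Chernoff bound.

For real `c i < 1` put `q x = ∑ (1 - c i) |x i|²`. Where `q v ≤ 1` on the sphere, i.e. `∑ c i |v i|²
≥ 0`, the radial integral of `exp (-q)` is at least that of `exp (-‖x‖²)`. Markov's inequality
therefore bounds the probability of this set by the ratio of two Gaussian integrals, which is `∏ (1
- c i)⁻¹` (`toSphere_sublevel_mul_le`, `uniformSphere_le_prod`).

With `c i = t (l i - m - ε)` the set is the upper tail event. The terms linear in `l i - m` sum to
zero, and optimizing over `t` gives `exp (-d ε² / (64 ‖B‖²))` (`prod_inv_one_sub_le_exp`). The lower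
tail follows by negating the eigenvalues, and `64 ≤ 36 π³`. -/

namespace QStat

/-! ### Gaussian integrals in polar coordinates -/

section GaussianTail

lemma lintegral_eq_lintegral_sphere_Ioi {E : Type*} [NormedAddCommGroup E] [NormedSpace ℝ E]
    [FiniteDimensional ℝ E] [Nontrivial E] [MeasurableSpace E] [BorelSpace E]
    (μ : Measure E) [μ.IsAddHaarMeasure] {f : E → ENNReal} (hf : Measurable f) :
    ∫⁻ x, f x ∂μ = ∫⁻ v : Metric.sphere (0 : E) 1, ∫⁻ r : Set.Ioi (0 : ℝ), f (r.1 • v.1)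
      ∂(Measure.volumeIoiPow (Module.finrank ℝ E - 1)) ∂μ.toSphere := by
  have hmp := μ.measurePreserving_homeomorphUnitSphereProd
  have hm : Measurable fun p : Metric.sphere (0 : E) 1 × Set.Ioi (0 : ℝ) => f (p.2.1 • p.1.1) :=
    hf.comp (by fun_prop)
  rw [← lintegral_prod (fun p : Metric.sphere (0 : E) 1 × Set.Ioi (0 : ℝ) => f (p.2.1 • p.1.1))
    hm.aemeasurable, ← hmp.lintegral_comp hm]
  have h1 : ∀ x : ({0}ᶜ : Set E), f ((homeomorphUnitSphereProd E x).2.1 •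
      (homeomorphUnitSphereProd E x).1.1) = f x := by
    intro x
    have hx : ‖(x : E)‖ ≠ 0 := norm_ne_zero_iff.2 x.2
    simp [smul_smul, hx]
  simp_rw [h1]
  -- Polar coordinates only cover the complement of the origin, which is a null set.
  rw [lintegral_subtype_comap (measurableSet_singleton (0 : E)).compl f,
    restrict_compl_singleton]

/-- Gaussian Chernoff bound for sublevel sets, on the sphere, of functions that are homogeneous
of degree two. -/
lemma toSphere_sublevel_mul_le {E : Type*} [NormedAddCommGroup E] [NormedSpace ℝ E]
    [FiniteDimensional ℝ E] [Nontrivial E] [MeasurableSpace E] [BorelSpace E]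
    (μ : Measure E) [μ.IsAddHaarMeasure] {q : E → ℝ} (hq : Measurable q)
    (hh : ∀ (r : ℝ) x, q (r • x) = r ^ 2 * q x) :
    μ.toSphere {v | q v ≤ 1} * ∫⁻ x, ENNReal.ofReal (Real.exp (-‖x‖ ^ 2)) ∂μ ≤
      μ.toSphere Set.univ * ∫⁻ x, ENNReal.ofReal (Real.exp (-q x)) ∂μ := by
  have m1 : Measurable fun x : E => ENNReal.ofReal (Real.exp (-‖x‖ ^ 2)) := by fun_prop
  have m2 : Measurable fun x : E => ENNReal.ofReal (Real.exp (-q x)) := by fun_prop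
  rw [lintegral_eq_lintegral_sphere_Ioi μ m1, lintegral_eq_lintegral_sphere_Ioi μ m2]
  simp only [hh, norm_smul, norm_eq_of_mem_sphere, mul_one, Real.norm_eq_abs, sq_abs]
  set ν := Measure.volumeIoiPow (Module.finrank ℝ E - 1)
  set G := ∫⁻ r : Set.Ioi (0 : ℝ), ENNReal.ofReal (Real.exp (-r.1 ^ 2)) ∂ν
  set F : Metric.sphere (0 : E) 1 → ENNReal := fun v =>
    ∫⁻ r : Set.Ioi (0 : ℝ), ENNReal.ofReal (Real.exp (-(r.1 ^ 2 * q v))) ∂ν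
  have mF : Measurable F := by
    have h : Measurable fun p : Metric.sphere (0 : E) 1 × Set.Ioi (0 : ℝ) =>
        ENNReal.ofReal (Real.exp (-(p.2.1 ^ 2 * q p.1))) := by fun_prop
    exact h.lintegral_prod_right'
  -- `F v` is the radial integral of `exp (-q)` along `v`, and `G` is its value for `q v = 1`. This
  -- reduces the claim to Markov's inequality for `F`.
  have hsub : {v : Metric.sphere (0 : E) 1 | q v ≤ 1} ⊆ {v | G ≤ F v} := by
    intro v hv
    refine lintegral_mono fun r => ENNReal.ofReal_le_ofReal (Real.exp_le_exp.2 ?_)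
    have : q v ≤ 1 := hv
    nlinarith [sq_nonneg r.1]
  calc _ = G * μ.toSphere {v | q v ≤ 1} * μ.toSphere Set.univ := by
        rw [lintegral_const]; ring
    _ ≤ G * μ.toSphere {v | G ≤ F v} * μ.toSphere Set.univ := by gcongr
    _ ≤ (∫⁻ v, F v ∂μ.toSphere) * μ.toSphere Set.univ := by
        gcongr
        exact mul_meas_ge_le_lintegral mF G
    _ = _ := mul_comm _ _

lemma integral_exp_neg_mul_sq_complex {a : ℝ} (ha : 0 < a) :
    ∫ z : ℂ, Real.exp (-(a * ‖z‖ ^ 2)) = Real.pi / a := by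
  have h := Complex.integral_exp_neg_mul_rpow (p := 2) (by norm_num) ha
  norm_num [Real.rpow_neg_one] at h
  simpa [div_eq_mul_inv] using h

lemma lintegral_exp_neg_sum_mul_sq_pi {ι : Type*} [Fintype ι] {a : ι → ℝ} (ha : ∀ i, 0 < a i) :
    ∫⁻ x : ι → ℂ, ENNReal.ofReal (Real.exp (-∑ i, a i * ‖x i‖ ^ 2)) =
      ENNReal.ofReal (∏ i, (Real.pi / a i)) := by
  have h : ∫ x : ι → ℂ, Real.exp (-∑ i, a i * ‖x i‖ ^ 2) = ∏ i, (Real.pi / a i) := by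
    simp_rw [← Finset.sum_neg_distrib, Real.exp_sum]
    rw [integral_fintype_prod_volume_eq_prod fun i (z : ℂ) => Real.exp (-(a i * ‖z‖ ^ 2))]
    exact Finset.prod_congr rfl fun i _ => integral_exp_neg_mul_sq_complex (ha i)
  have hpos : 0 < ∏ i, (Real.pi / a i) := Finset.prod_pos fun i _ => div_pos Real.pi_pos (ha i)
  have hint : Integrable fun x : ι → ℂ => Real.exp (-∑ i, a i * ‖x i‖ ^ 2) := by
    -- The Bochner integral of a non-integrable function is `0`, whereas the value in `h` is
    -- positive.
    by_contra hn
    rw [integral_undef hn] at h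
    exact hpos.ne h
  rw [← h, ofReal_integral_eq_lintegral_ofReal hint (ae_of_all _ fun x => (Real.exp_pos _).le)]

/-- By uniqueness of Haar measure, `μ` is a multiple of Lebesgue measure in the coordinates of `b`.
The factor need not be computed: it does not depend on `a` and cancels in ratios. -/
lemma exists_lintegral_exp_neg_sum_mul_sq {E ι : Type*} [Fintype ι] [NormedAddCommGroup E]
    [InnerProductSpace ℂ E] [MeasurableSpace E] [BorelSpace E]
    (μ : Measure E) [μ.IsAddHaarMeasure] (b : OrthonormalBasis ι ℂ E) :
    ∃ c : ENNReal, c ≠ 0 ∧ c ≠ ⊤ ∧ ∀ a : ι → ℝ, (∀ i, 0 < a i) →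
      ∫⁻ x, ENNReal.ofReal (Real.exp (-∑ i, a i * ‖b.repr x i‖ ^ 2)) ∂μ =
        c * ENNReal.ofReal (∏ i, (Real.pi / a i)) := by
  let e' : E ≃L[ℂ] (ι → ℂ) :=
    b.repr.toContinuousLinearEquiv.trans (PiLp.continuousLinearEquiv 2 ℂ fun _ : ι => ℂ)
  let e : E ≃L[ℝ] (ι → ℂ) :=
    { e'.toLinearEquiv.restrictScalars ℝ with
      continuous_toFun := e'.continuous
      continuous_invFun := e'.symm.continuous }
  have hμ : (μ.map e).IsAddHaarMeasure := e.isAddHaarMeasure_map μ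
  obtain ⟨k, hk, key⟩ : ∃ k : NNReal, k ≠ 0 ∧ μ.map e = k • (volume : Measure (ι → ℂ)) :=
    ⟨_, (Measure.addHaarScalarFactor_pos_of_isAddHaarMeasure _ _).ne',
      Measure.isAddLeftInvariant_eq_smul (μ.map e) volume⟩
  refine ⟨k, by exact_mod_cast hk, by simp, ?_⟩
  · intro a ha
    have hm : Measurable fun x : ι → ℂ => ENNReal.ofReal (Real.exp (-∑ i, a i * ‖x i‖ ^ 2)) := by
      fun_prop
    have hmap : ∫⁻ x, ENNReal.ofReal (Real.exp (-∑ i, a i * ‖b.repr x i‖ ^ 2)) ∂μ =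
        ∫⁻ x, ENNReal.ofReal (Real.exp (-∑ i, a i * ‖x i‖ ^ 2)) ∂(μ.map e) :=
      (lintegral_map hm e.continuous.measurable).symm
    rw [hmap, key, lintegral_smul_measure, lintegral_exp_neg_sum_mul_sq_pi ha]
    rfl

/-- For `u ≥ 0`, `exp (u + u²) ≥ 1 + u + 3u²/2`, and multiplying by `1 - u` gives `1 + u²/2 - 3u³/2
≥ 1`. For `u ≤ 0`, `(1 - u)(1 + u + u²) = 1 - u³ ≥ 1` suffices. -/
lemma inv_one_sub_le_exp {u : ℝ} (hu : u ≤ 1 / 4) :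
    (1 - u)⁻¹ ≤ Real.exp (u + u ^ 2) := by
  rw [inv_le_iff_one_le_mul₀' (by linarith)]
  rcases le_total 0 u with h | h
  · have := Real.quadratic_le_exp_of_nonneg (x := u + u ^ 2) (by positivity)
    have h3 : 1 + u + 3 / 2 * u ^ 2 ≤ Real.exp (u + u ^ 2) := by
      nlinarith [pow_nonneg h 3, pow_nonneg h 4]
    nlinarith [mul_le_mul_of_nonneg_left h3 (show 0 ≤ 1 - u by linarith), sq_nonneg u,
      mul_nonneg (sq_nonneg u) (show 0 ≤ 1 / 4 - u by linarith)]
  · have h3 := Real.add_one_le_exp (u + u ^ 2)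
    nlinarith [mul_le_mul_of_nonneg_left h3 (show 0 ≤ 1 - u by linarith),
      mul_nonneg (sq_nonneg u) (neg_nonneg.2 h)]

end GaussianTail

/-! ### Tail bounds for diagonal quadratic forms on the sphere -/

section Tail

variable {E ι : Type*} [Fintype ι] [NormedAddCommGroup E] [InnerProductSpace ℂ E]
  [FiniteDimensional ℂ E] [MeasurableSpace E] [BorelSpace E]

/-- Chernoff bound for a quadratic form that is diagonal in an orthonormal basis. -/
lemma uniformSphere_le_prod [Nontrivial E] (b : OrthonormalBasis ι ℂ E) {c : ι → ℝ}
    (hc : ∀ i, c i < 1) :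
    uniformSphere E {v | 0 ≤ ∑ i, c i * ‖b.repr v i‖ ^ 2} ≤
      ENNReal.ofReal (∏ i, (1 - c i)⁻¹) := by
  have : FiniteDimensional ℝ E := FiniteDimensional.complexToReal E
  obtain ⟨k, hk0, hkt, hk⟩ := exists_lintegral_exp_neg_sum_mul_sq (lebesgue E) b
  have hsq : ∀ x : E, ∑ i, ‖b.repr x i‖ ^ 2 = ‖x‖ ^ 2 := fun x => by
    rw [← EuclideanSpace.norm_sq_eq, b.repr.norm_map]
  have hcont : Continuous fun x : E => ∑ i, (1 - c i) * ‖b.repr x i‖ ^ 2 := by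
    have : ∀ i, Continuous fun x : E => b.repr x i := fun i =>
      (EuclideanSpace.proj (𝕜 := ℂ) i).continuous.comp b.repr.continuous
    fun_prop
  have hhom : ∀ (r : ℝ) (x : E), ∑ i, (1 - c i) * ‖b.repr (r • x) i‖ ^ 2 =
      r ^ 2 * ∑ i, (1 - c i) * ‖b.repr x i‖ ^ 2 := by
    intro r x
    rw [Finset.mul_sum]
    refine Finset.sum_congr rfl fun i _ => ?_
    have : r • x = (r : ℂ) • x := (Complex.coe_smul r x).symm
    rw [this, map_smul, PiLp.smul_apply, norm_smul, Complex.norm_real, Real.norm_eq_abs, mul_pow,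
      sq_abs]
    ring
  have h := toSphere_sublevel_mul_le (lebesgue E) hcont.measurable hhom
  -- On the sphere the form `∑ (1 - c i) |v i|²` equals `1 - ∑ c i |v i|²`.
  have hset : {v : Metric.sphere (0 : E) 1 | ∑ i, (1 - c i) * ‖b.repr v i‖ ^ 2 ≤ 1} =
      {v : Metric.sphere (0 : E) 1 | 0 ≤ ∑ i, c i * ‖b.repr v i‖ ^ 2} := by
    ext v
    simp [sub_mul, Finset.sum_sub_distrib, hsq]
  have h1 := hk (fun _ => 1) fun _ => one_pos
  simp only [one_mul, hsq, div_one] at h1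
  have h2 := hk (fun i => 1 - c i) fun i => sub_pos.2 (hc i)
  have hpi : 0 < ∏ _i : ι, Real.pi := Finset.prod_pos fun _ _ => Real.pi_pos
  rw [hset, h1, h2] at h
  simp only [div_eq_mul_inv, Finset.prod_mul_distrib] at h
  rw [ENNReal.ofReal_mul hpi.le] at h
  set p := ENNReal.ofReal (∏ _i : ι, Real.pi)
  have hp0 : p ≠ 0 := (ENNReal.ofReal_pos.2 hpi).ne'
  have hpt : p ≠ ⊤ := ENNReal.ofReal_ne_top
  have hs0 : (lebesgue E).toSphere Set.univ ≠ 0 := by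
    rw [Ne, Measure.measure_univ_eq_zero]
    exact Measure.toSphere_ne_zero _
  have hst : (lebesgue E).toSphere Set.univ ≠ ⊤ := measure_ne_top _ _
  rw [uniformSphere, Measure.smul_apply, smul_eq_mul,
    ENNReal.inv_mul_le_iff hs0 hst, ← ENNReal.mul_le_mul_iff_left (mul_ne_zero hk0 hp0)
      (ENNReal.mul_ne_top hkt hpt)]
  refine h.trans_eq ?_
  ring

/-- With `t = ε / (32 L²)` and `|l i - m - ε| ≤ 4L`, each factor is at most `exp (t (l i - m - ε) +
16 t² L²)`. Since the `l i - m` sum to zero, the total exponent is `d (-t ε + 16 t² L²)`, with `d`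
the number of indices; this `t` minimizes it. -/
lemma prod_inv_one_sub_le_exp {l : ι → ℝ} {L m ε : ℝ} (hL : 0 < L) (hε : 0 < ε)
    (hεL : ε ≤ 2 * L) (hl : ∀ i, |l i - m| ≤ 2 * L)
    (hm : ∑ i, l i = Fintype.card ι * m) :
    (∀ i, ε / (32 * L ^ 2) * (l i - m - ε) < 1) ∧
    ∏ i, (1 - ε / (32 * L ^ 2) * (l i - m - ε))⁻¹ ≤
      Real.exp (-(Fintype.card ι * ε ^ 2 / (64 * L ^ 2))) := by
  set t := ε / (32 * L ^ 2) with ht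
  have ht0 : 0 < t := by positivity
  -- Here `ε ≤ 2L` enters: `t * (4L) = ε / (8L)`, which meets the hypothesis of
  -- `inv_one_sub_le_exp`.
  have htL : t * (4 * L) ≤ 1 / 4 := by
    rw [ht, div_mul_eq_mul_div, div_le_iff₀ (by positivity)]
    nlinarith
  have hc : ∀ i, |l i - m - ε| ≤ 4 * L := fun i => by
    have := abs_le.1 (hl i)
    exact abs_le.2 ⟨by linarith, by linarith⟩
  have hu : ∀ i, |t * (l i - m - ε)| ≤ 1 / 4 := fun i => by
    rw [abs_mul, abs_of_pos ht0]
    exact (mul_le_mul_of_nonneg_left (hc i) ht0.le).trans htL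
  have hu' := fun i => abs_le.1 (hu i)
  refine ⟨fun i => by linarith [(hu' i).2], ?_⟩
  calc ∏ i, (1 - t * (l i - m - ε))⁻¹
      ≤ ∏ i, Real.exp (t * (l i - m - ε) + t ^ 2 * (4 * L) ^ 2) := by
        refine Finset.prod_le_prod (fun i _ => inv_nonneg.2 (by linarith [(hu' i).2]))
          fun i _ => (inv_one_sub_le_exp (hu' i).2).trans ?_
        rw [mul_pow, Real.exp_le_exp, ← sq_abs (l i - m - ε)]
        gcongr
        exact hc i
    _ = Real.exp (-(Fintype.card ι * ε ^ 2 / (64 * L ^ 2))) := by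
        rw [← Real.exp_sum, Finset.sum_add_distrib, ← Finset.mul_sum, Finset.sum_sub_distrib,
          Finset.sum_sub_distrib, hm]
        simp only [Finset.sum_const, Finset.card_univ, nsmul_eq_mul]
        congr 1
        rw [ht]
        field_simp
        ring

lemma uniformSphere_le_exp [Nontrivial E] (b : OrthonormalBasis ι ℂ E) {l : ι → ℝ} {L m ε : ℝ}
    (hL : 0 < L) (hε : 0 < ε) (hl : ∀ i, |l i - m| ≤ 2 * L)
    (hm : ∑ i, l i = Fintype.card ι * m) :
    uniformSphere E {v | ε ≤ ∑ i, (l i - m) * ‖b.repr v i‖ ^ 2} ≤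
      ENNReal.ofReal (Real.exp (-(Fintype.card ι * ε ^ 2 / (64 * L ^ 2)))) := by
  have hsq : ∀ v : Metric.sphere (0 : E) 1, ∑ i, ‖b.repr v i‖ ^ 2 = 1 := fun v => by
    rw [← EuclideanSpace.norm_sq_eq, b.repr.norm_map, norm_eq_of_mem_sphere, one_pow]
  rcases le_or_gt ε (2 * L) with hεL | hεL
  · obtain ⟨h1, h2⟩ := prod_inv_one_sub_le_exp hL hε hεL hl hm
    refine (measure_mono fun v hv => ?_).trans
      ((uniformSphere_le_prod b h1).trans (ENNReal.ofReal_le_ofReal h2))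
    have hv' : ε ≤ ∑ i, (l i - m) * ‖b.repr v i‖ ^ 2 := hv
    have : ∑ i, ε / (32 * L ^ 2) * (l i - m - ε) * ‖b.repr v i‖ ^ 2 =
        ε / (32 * L ^ 2) * (∑ i, (l i - m) * ‖b.repr v i‖ ^ 2 - ε) := by
      simp_rw [mul_assoc, ← Finset.mul_sum, sub_mul _ ε, Finset.sum_sub_distrib, ← Finset.mul_sum,
        hsq, mul_one]
    rw [Set.mem_ofPred_eq, this]
    exact mul_nonneg (by positivity) (sub_nonneg.2 hv')
  -- The form is an average of the `l i - m` with weights `|v i|²`, so it never exceeds `2L`.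
  · have : {v : Metric.sphere (0 : E) 1 | ε ≤ ∑ i, (l i - m) * ‖b.repr v i‖ ^ 2} = ∅ := by
      refine Set.eq_empty_of_forall_notMem fun v hv => ?_
      have hv' : ε ≤ ∑ i, (l i - m) * ‖b.repr v i‖ ^ 2 := hv
      have : ∑ i, (l i - m) * ‖b.repr v i‖ ^ 2 ≤ ∑ i, 2 * L * ‖b.repr v i‖ ^ 2 :=
        Finset.sum_le_sum fun i _ => by
          gcongr
          exact (le_abs_self _).trans (hl i)
      rw [← Finset.mul_sum, hsq, mul_one] at this
      linarith
    rw [this, measure_empty]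
    exact zero_le

/-- Two-sided concentration of a diagonal quadratic form on the unit sphere. -/
lemma uniformSphere_abs_le_exp [Nontrivial E] (b : OrthonormalBasis ι ℂ E) {l : ι → ℝ}
    {L m ε : ℝ} (hL : 0 < L) (hε : 0 < ε) (hl : ∀ i, |l i - m| ≤ 2 * L)
    (hm : ∑ i, l i = Fintype.card ι * m) :
    uniformSphere E {v | ε ≤ |∑ i, (l i - m) * ‖b.repr v i‖ ^ 2|} ≤
      ENNReal.ofReal (2 * Real.exp (-(Fintype.card ι * ε ^ 2 / (64 * L ^ 2)))) := by
  have h1 := uniformSphere_le_exp b hL hε hl hm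
  have h2 := uniformSphere_le_exp b (l := fun i => -l i) (m := -m) hL hε
    (fun i => by rw [neg_sub_neg, abs_sub_comm]; exact hl i) (by simp [hm])
  rw [two_mul, ENNReal.ofReal_add (Real.exp_pos _).le (Real.exp_pos _).le]
  refine (measure_mono fun v hv => ?_).trans ((measure_union_le _ _).trans (add_le_add h1 h2))
  rcases le_abs.1 (show ε ≤ |∑ i, (l i - m) * ‖b.repr v i‖ ^ 2| from hv) with h | h
  · exact Or.inl h
  · refine Or.inr (h.trans_eq ?_)
    rw [← Finset.sum_neg_distrib]
    exact Finset.sum_congr rfl fun i _ => by ring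

end Tail

/-! ### Reduction from the whole space to the subspace -/

section Compression

variable {H : Type*} [NormedAddCommGroup H] [InnerProductSpace ℂ H] [FiniteDimensional ℂ H]

/-- The compression of an operator to a subspace. -/
noncomputable def compression (K : Submodule ℂ H) (B : H →L[ℂ] H) : K →ₗ[ℂ] K :=
  (K.orthogonalProjectionOnto ∘L B ∘L K.subtypeL : K →L[ℂ] K)

lemma inner_compression (K : Submodule ℂ H) (B : H →L[ℂ] H) (v w : K) :
    inner ℂ v (compression K B w) = inner ℂ (v : H) (B w) :=
  Submodule.inner_orthogonalProjectionOnto_eq_of_mem_left v (B w)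

lemma isSymmetric_compression (K : Submodule ℂ H) {B : H →L[ℂ] H}
    (hB : (B : H →ₗ[ℂ] H).IsSymmetric) : (compression K B).IsSymmetric := by
  intro v w
  rw [inner_compression, ← inner_conj_symm, inner_compression, inner_conj_symm]
  exact hB v w

/-- Cyclicity of the trace, applied to maps between `H` and `K`, moves the projection onto `K` to
the front. -/
lemma expectation_eq_trace (K : Submodule ℂ H) (B : H →L[ℂ] H) (ψ : PureState K) :
    expectation B ψ = LinearMap.trace ℂ K (compression K B ∘ₗ (ψ.1 : K →ₗ[ℂ] K)) := by
  have h1 : ((B ∘L ψ.extend : H →L[ℂ] H) : H →ₗ[ℂ] H) =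
      ((B ∘L K.subtypeL ∘L ψ.1 : K →L[ℂ] H) : K →ₗ[ℂ] H) ∘ₗ
        (K.orthogonalProjectionOnto : H →ₗ[ℂ] K) := by
    ext x
    simp [PureState.extend]
  rw [expectation, h1, LinearMap.trace_comp_comm']
  congr 1

lemma microcanonicalExpectation_eq_trace (K : Submodule ℂ H) (B : H →L[ℂ] H) :
    microcanonicalExpectation K B =
      (Module.finrank ℂ K : ℂ)⁻¹ * LinearMap.trace ℂ K (compression K B) := by
  have h : ((B ∘L microcanonicalState K : H →L[ℂ] H) : H →ₗ[ℂ] H) =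
      (Module.finrank ℂ K : ℂ)⁻¹ • (((B ∘L K.subtypeL : K →L[ℂ] H) : K →ₗ[ℂ] H) ∘ₗ
        (K.orthogonalProjectionOnto : H →ₗ[ℂ] K)) := by
    ext x
    simp [microcanonicalState]
  rw [microcanonicalExpectation, h, map_smul, smul_eq_mul]
  exact congrArg _ (LinearMap.trace_comp_comm' _ _)

lemma expectation_ofVector (K : Submodule ℂ H) (B : H →L[ℂ] H) (v : Metric.sphere (0 : K) 1) :
    expectation B (PureState.ofVector v) = inner ℂ (v : K) (compression K B v) := by
  rw [expectation_eq_trace, LinearMap.trace_comp_comm']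
  have h : ((PureState.ofVector v).1 : K →ₗ[ℂ] K) ∘ₗ compression K B =
      LinearMap.smulRight (innerₛₗ ℂ (v : K) ∘ₗ compression K B) (v : K) := by
    ext x
    simp [PureState.ofVector]
  rw [h, LinearMap.trace_smulRight]
  rfl

lemma measurable_expectation [MeasurableSpace H] [BorelSpace H] (K : Submodule ℂ H)
    (B : H →L[ℂ] H) : Measurable fun ψ : PureState K => expectation B ψ := by
  simp_rw [expectation_eq_trace]
  let T : (K →L[ℂ] K) →ₗ[ℂ] ℂ := LinearMap.trace ℂ K ∘ₗ
    LinearMap.compRight ℂ (compression K B) ∘ₗ ContinuousLinearMap.coeLM ℂ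
  exact T.continuous_of_finiteDimensional.measurable.comp measurable_subtype_coe

end Compression

/-! ### Concentration under the Haar measure on pure states -/

section Concentration

variable {H : Type*} [NormedAddCommGroup H] [InnerProductSpace ℂ H] [FiniteDimensional ℂ H]
  [MeasurableSpace H] [BorelSpace H]

lemma haar_le_exp {K : Submodule ℂ H} [Nontrivial K] {B : H →L[ℂ] H}
    (hB : (B : H →ₗ[ℂ] H).IsSymmetric) (hB0 : B ≠ 0) {ε : ℝ} (hε : 0 < ε) :
    PureState.haar K {ψ | ε ≤ ‖expectation B ψ - microcanonicalExpectation K B‖} ≤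
      ENNReal.ofReal (2 * Real.exp (-(Module.finrank ℂ K * ε ^ 2 / (64 * ‖B‖ ^ 2)))) := by
  have hT := isSymmetric_compression K hB
  set d := Module.finrank ℂ K with hd
  obtain ⟨b, l, happly, hrepr, htrace⟩ : ∃ (b : OrthonormalBasis (Fin d) ℂ K) (l : Fin d → ℝ),
      (∀ i, compression K B (b i) = (l i : ℂ) • b i) ∧
      (∀ v i, b.repr (compression K B v) i = l i * b.repr v i) ∧
      LinearMap.trace ℂ K (compression K B) = ∑ i, l i :=
    ⟨hT.eigenvectorBasis hd.symm, hT.eigenvalues hd.symm, hT.apply_eigenvectorBasis hd.symm,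
      hT.eigenvectorBasis_apply_self_apply hd.symm, by
        simpa using hT.trace_eq_sum_eigenvalues hd.symm⟩
  have hd0 : (d : ℝ) ≠ 0 := by exact_mod_cast (Module.finrank_pos (R := ℂ) (M := K)).ne'
  set m : ℝ := (d : ℝ)⁻¹ * ∑ i, l i with hm
  have hL : 0 < ‖B‖ := norm_pos_iff.2 hB0
  -- Each `l i` is the expectation of `B` in the unit vector `b i`. The mean `m` obeys the same
  -- bound, hence the spread `2 ‖B‖`.
  have hlB : ∀ i, |l i| ≤ ‖B‖ := by
    intro i
    have h1 : inner ℂ ((b i : K) : H) (B (b i)) = (l i : ℂ) := by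
      rw [← inner_compression, happly, inner_smul_right,
        inner_self_eq_norm_sq_to_K, b.norm_eq_one]
      simp
    have hn : ‖((b i : K) : H)‖ = 1 := b.norm_eq_one i
    rw [← Real.norm_eq_abs, ← Complex.norm_real, ← h1]
    refine (norm_inner_le_norm _ _).trans ?_
    rw [hn, one_mul]
    exact (B.le_opNorm _).trans (by rw [hn, mul_one])
  have hsum : ∑ i, l i = d * m := by rw [hm, mul_inv_cancel_left₀ hd0]
  have hmB : |m| ≤ ‖B‖ := by
    have h1 : |∑ i, l i| ≤ d * ‖B‖ := by
      refine (Finset.abs_sum_le_sum_abs _ _).trans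
        ((Finset.sum_le_sum fun i _ => hlB i).trans_eq ?_)
      simp [d]
    rw [hsum, abs_mul, Nat.abs_cast] at h1
    exact le_of_mul_le_mul_left h1 (lt_of_le_of_ne (Nat.cast_nonneg d) hd0.symm)
  have hl : ∀ i, |l i - m| ≤ 2 * ‖B‖ := fun i =>
    (abs_sub _ _).trans (by linarith [hlB i])
  have hmc : microcanonicalExpectation K B = (m : ℂ) := by
    rw [microcanonicalExpectation_eq_trace, htrace, ← hd]
    simp [hm]
  have hexp : ∀ v : Metric.sphere (0 : K) 1,
      expectation B (PureState.ofVector v) - microcanonicalExpectation K B =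
        ((∑ i, (l i - m) * ‖b.repr v i‖ ^ 2 : ℝ) : ℂ) := by
    intro v
    have h1 : ∑ i, ‖b.repr v i‖ ^ 2 = 1 := by
      rw [← EuclideanSpace.norm_sq_eq, b.repr.norm_map, norm_eq_of_mem_sphere, one_pow]
    have h2 : inner ℂ (v : K) (compression K B v) =
        ((∑ i, l i * ‖b.repr v i‖ ^ 2 : ℝ) : ℂ) := by
      rw [← b.repr.inner_map_map, PiLp.inner_apply, Complex.ofReal_sum]
      refine Finset.sum_congr rfl fun i _ => ?_
      rw [hrepr, RCLike.inner_apply, mul_assoc,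
        RCLike.mul_conj]
      simp
    simp_rw [sub_mul, Finset.sum_sub_distrib, ← Finset.mul_sum, h1, mul_one]
    rw [expectation_ofVector, h2, hmc, Complex.ofReal_sub]
  -- The Haar measure is a push-forward, so measurability of the event is what allows it to be
  -- pulled back to the sphere.
  have hmeas : MeasurableSet
      {ψ : PureState K | ε ≤ ‖expectation B ψ - microcanonicalExpectation K B‖} :=
    measurableSet_le measurable_const ((measurable_expectation K B).sub_const _).norm
  rw [PureState.haar, Measure.map_apply PureState.measurable_ofVector hmeas]
  have hpre : PureState.ofVector ⁻¹'
      {ψ : PureState K | ε ≤ ‖expectation B ψ - microcanonicalExpectation K B‖} =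
      {v : Metric.sphere (0 : K) 1 | ε ≤ |∑ i, (l i - m) * ‖b.repr v i‖ ^ 2|} := by
    ext v
    rw [Set.mem_preimage, Set.mem_ofPred_eq, hexp, Complex.norm_real, Real.norm_eq_abs]
    rfl
  rw [hpre]
  have h := uniformSphere_abs_le_exp b hL hε hl (by rw [Fintype.card_fin]; exact hsum)
  rwa [Fintype.card_fin] at h

end Concentration

end QStat

theorem mainTheorem1 {H : Type*} [NormedAddCommGroup H] [InnerProductSpace ℂ H]
    [FiniteDimensional ℂ H] [MeasurableSpace H] [BorelSpace H]
    (K : Submodule ℂ H) (hK : K ≠ ⊥)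
    (B : H →L[ℂ] H) (hB : (B : H →ₗ[ℂ] H).IsSymmetric)
    (ε : ℝ) (hε : 0 < ε) :
    (B ≠ 0 →
      (QStat.PureState.haar K).real
          {ψ | ε ≤ ‖QStat.expectation B ψ - QStat.microcanonicalExpectation K B‖}
        ≤ 2 * Real.exp
            (-((36 * Real.pi ^ 3)⁻¹ * (Module.finrank ℂ K : ℝ) * ε ^ 2 / ‖B‖ ^ 2))) ∧
    (B = 0 →
      (QStat.PureState.haar K).real
          {ψ | ε ≤ ‖QStat.expectation B ψ - QStat.microcanonicalExpectation K B‖} = 0) := by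
  refine ⟨fun hB0 => ?_, ?_⟩
  · have : Nontrivial K := Submodule.nontrivial_iff_ne_bot.2 hK
    refine (ENNReal.toReal_le_of_le_ofReal (by positivity) (QStat.haar_le_exp hB hB0 hε)).trans ?_
    -- Already `π > 3` gives `36 π³ > 972`, so the stated constant is weaker than `1/64`.
    have hpi : (36 * Real.pi ^ 3)⁻¹ ≤ (64 : ℝ)⁻¹ := by
      have := pow_le_pow_left₀ (by norm_num) Real.pi_gt_three.le 3
      exact inv_anti₀ (by norm_num) (by linarith)
    have hexp : (36 * Real.pi ^ 3)⁻¹ * (Module.finrank ℂ K : ℝ) * ε ^ 2 / ‖B‖ ^ 2 ≤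
        Module.finrank ℂ K * ε ^ 2 / (64 * ‖B‖ ^ 2) :=
      calc _ ≤ 64⁻¹ * (Module.finrank ℂ K : ℝ) * ε ^ 2 / ‖B‖ ^ 2 := by gcongr
        _ = _ := by ring
    exact mul_le_mul_of_nonneg_left (Real.exp_le_exp.2 (neg_le_neg hexp)) zero_le_two
  -- For `B = 0` both expectations vanish, and the event is empty because `ε > 0`.
  · rintro rfl
    simp [QStat.expectation, QStat.microcanonicalExpectation, hε.not_ge]
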